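/- Let $k$ be a field of characteristic zero. Let $\mathcal H_{CK}$ be the Connes--Kreimer Hopf algebra: the free commutative $k$-algebra on the (non-empty, non-planar) rooted trees, whose coproduct is the multiplicative extension of $\Delta(t)=\sum v\otimes w$, the sum over all partitions $V\sqcup W$ of the vertex set of the tree $t$ such that $x<y$ for all comparable $x\in W$, $y\in V$ (the order being $x\le y$ iff the path from the root to $y$ passes through $x$), where $v,w$ are the forests induced on $V,W$; its counit $\varepsilon$ vanishes on non-empty forests. Let $B_+$ be the linear operator on $\mathcal H_{CK}$ that grafts the trees of a forest on a common new root. Let $\mathcal A=T(k)$, with basis the words $x^n$ ($n\ge 0$) in one letter $x$, be the quasi-shuffle Hopf algebra: its product $\diamond$ is bilinear with unit $x^0$ and $x^{m+1}\diamond x^{n+1}=x\,(x^m\diamond x^{n+1})+x\,(x^{m+1}\diamond x^n)+x\,(x^m\diamond x^n)$, its coproduct is deconcatenation $\Delta(x^n)=\sum_{i=0}^n x^i\otimes x^{n-i}$, and its counit is the coefficient of $x^0$. Let $L:\mathcal A\to\mathcal A$ be the concatenation operator $x^n\mapsto x^{n+1}$, and let $\Lambda:\mathcal H_{CK}\to\mathcal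 A$ be the algebra morphism defined recursively by $\Lambda(B_+(t_1\cdots t_n))=(\Lambda(t_1)\diamond\cdots\diamond\Lambda(t_n))\,x$. For a linear form $f$ with $f(1)=1$ on either of these coalgebras put $\log^* f=\sum_{n\ge1}\frac{(-1)^{n+1}}{n}(f-\varepsilon)^{*n}$, where $*$ is the convolution product. Let $\delta$ be the character of $\mathcal H_{CK}$ equal to $1$ on the one-vertex tree and to $0$ on all other trees, and let $\widetilde\delta:\mathcal A\to k$ be the linear form with $\widetilde\delta(x^0)=\widetilde\delta(x)=1$ and $\widetilde\delta(x^s)=0$ for $s\ge2$. Set $\omega=\log^*\delta$ and $\widetilde\omega=\log^*\widetilde\delta$. Then: 1. $\Lambda$ is the unique Hopf algebra morphism with $\Lambda\circ B_+=L\circ\Lambda$ (it is compatible with the coproducts and the counits, and it is unique even among algebra morphisms with this property). 2. On every element of $\mathcal H_{CK}$, resp. $\mathcal A$, only finitely many of the convolution powers $(\delta-\varepsilon)^{*n}$, resp. $(\widetilde\delta-\varepsilon)^{*n}$, are non-zero, so that $\omega$ and $\widetilde\omega$ are well defined. 3. $\omega=\widetilde\omega\circ\Lambda$. 4. $\widetilde\omega(x^s)=\dfrac{(-1)^{s+1}}{s}$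 for every $s\ge1$. 5. For every rooted tree $t$ with $|t|$ vertices let $\omega_s(t)$ be the coefficient of $x^s$ in $\Lambda(t)$. Then $\Lambda(t)=\sum_{s=1}^{|t|}\omega_s(t)\,x^s$ and $$\omega(t)=\sum_{s\ge1}\frac{(-1)^{s+1}}{s}\,\omega_s(t).$$ -/

import Mathlib

open scoped TensorProduct

/-! ## Rooted trees -/

/-- Planar rooted trees: a root with an ordered finite family of branches. -/
inductive PTree : Type
  | node (n : ℕ) (c : Fin n → PTree) : PTree

namespace PTree

/-- Isomorphism of the underlying non-planar rooted trees: a bijection between the branches of the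
roots which matches isomorphic branches. -/
def Iso : PTree → PTree → Prop
  | node n c, node m d => ∃ σ : Fin n ≃ Fin m, ∀ i, Iso (c i) (d (σ i))

theorem Iso.refl : ∀ t : PTree, Iso t t
  | node _ c => ⟨Equiv.refl _, fun i => Iso.refl (c i)⟩

theorem Iso.symm : ∀ {s t : PTree}, Iso s t → Iso t s
  | node _ c, node _ d, ⟨σ, h⟩ => ⟨σ.symm, fun i => by
      have := Iso.symm (h (σ.symm i))
      rwa [Equiv.apply_symm_apply] at this⟩

theorem Iso.trans : ∀ {s t u : PTree}, Iso s t → Iso t u → Iso s u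
  | node _ _, node _ _, node _ _, ⟨σ, h⟩, ⟨τ, g⟩ =>
    ⟨σ.trans τ, fun i => Iso.trans (h i) (g (σ i))⟩

instance setoid : Setoid PTree := ⟨Iso, Iso.refl, Iso.symm, Iso.trans⟩

/-- The number of vertices. -/
def numVerts : PTree → ℕ
  | node _ c => 1 + ∑ i, numVerts (c i)

theorem Iso.numVerts_eq : ∀ {s t : PTree}, Iso s t → numVerts s = numVerts t
  | node _ c, node _ d, ⟨σ, h⟩ => by
    simp only [numVerts]
    congr 1
    exact Fintype.sum_equiv σ _ _ fun i => (h i).numVerts_eq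

/-- The vertices of a tree: the root `⊥`, and the vertices of the branches. -/
def Vert : PTree → Type
  | node n c => WithBot (Σ i : Fin n, Vert (c i))

/-- `x ≤ y` if and only if the path from the root to `y` passes through `x`; vertices of distinct
branches are not comparable. -/
instance vertOrder : ∀ t : PTree, PartialOrder (Vert t)
  | node n c =>
    letI : ∀ i, PartialOrder (Vert (c i)) := fun i => vertOrder (c i)
    inferInstanceAs (PartialOrder (WithBot (Σ i : Fin n, Vert (c i))))

instance vertFintype : ∀ t : PTree, Fintype (Vert t)
  | node n c =>
    letI : ∀ i, Fintype (Vert (c i)) := fun i => vertFintype (c i)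
    inferInstanceAs (Fintype (Option (Σ i : Fin n, Vert (c i))))

end PTree

/-- Non-planar (non-empty) rooted trees, up to isomorphism. -/
def RTree : Type := Quotient PTree.setoid

namespace RTree

/-- The tree obtained by grafting the trees of a forest on a common new root. -/
noncomputable def graft (s : Multiset RTree) : RTree :=
  Quotient.mk _ (PTree.node s.toList.length fun i => Quotient.out (s.toList.get i))

/-- The tree with one vertex. -/
noncomputable def bullet : RTree := graft 0

/-- The number of vertices of a rooted tree. -/
def numVerts : RTree → ℕ := Quotient.lift PTree.numVerts fun _ _ h => PTree.Iso.numVerts_eq h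

end RTree

namespace PTree

/-- The root of a tree. -/
def Vert.root {n : ℕ} {c : Fin n → PTree} : Vert (node n c) :=
  (⊥ : WithBot (Σ i : Fin n, Vert (c i)))

/-- The vertex `v` of the `i`-th branch of a tree. -/
def Vert.inBranch {n : ℕ} {c : Fin n → PTree} (i : Fin n) (v : Vert (c i)) : Vert (node n c) :=
  ((⟨i, v⟩ : Σ i : Fin n, Vert (c i)) : WithBot (Σ i : Fin n, Vert (c i)))

/-- The vertices in `W` which belong to the `i`-th branch. -/
def branchSet {n : ℕ} {c : Fin n → PTree} (W : Set (Vert (node n c))) (i : Fin n) :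
    Set (Vert (c i)) := {v | Vert.inBranch i v ∈ W}

open Classical in
/-- The connected components of the forest which a set `W` of vertices of a tree defines, by
keeping the edges which link two elements of `W`. The first entry holds the component of the root
(it is empty if the root is not in `W`), the second entry holds all the other components. -/
noncomputable def components : (t : PTree) → Set (Vert t) → Multiset RTree × Multiset RTree
  | node _ c, W =>
    let A : Multiset RTree := ∑ i, (components (c i) (branchSet W i)).1
    let B : Multiset RTree := ∑ i, (components (c i) (branchSet W i)).2
    if Vert.root ∈ W then ({RTree.graft A}, B) else (0, A + B)

/-- The subforest which a set of vertices of a tree defines. -/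
noncomputable def subforest (t : PTree) (W : Set (Vert t)) : Multiset RTree :=
  (components t W).1 + (components t W).2

/-- The set `W` of vertices is the trunk of an admissible cut (and its complement is the crown):
`x < y` for all comparable vertices `x` in the trunk and `y` in the crown. -/
def IsTrunk (t : PTree) (W : Set (Vert t)) : Prop :=
  ∀ x ∈ W, ∀ y ∈ Wᶜ, x ≤ y ∨ y ≤ x → x < y

end PTree

/-! ## The Connes-Kreimer Hopf algebra -/

/-- The free commutative algebra on the rooted trees. Its monomials are the rooted forests. -/
def HCK (k : Type*) [Field k] : Type _ := MvPolynomial RTree k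

namespace HCK

variable (k : Type*) [Field k]

noncomputable instance : CommRing (HCK k) := inferInstanceAs (CommRing (MvPolynomial RTree k))

noncomputable instance : Algebra k (HCK k) :=
  inferInstanceAs (Algebra k (MvPolynomial RTree k))

/-- The rooted tree `t` as an element of the algebra. -/
noncomputable def tree (t : RTree) : HCK k := MvPolynomial.X (R := k) t

/-- The rooted forest `s` (the product of its trees) as an element of the algebra. -/
noncomputable def forest (s : Multiset RTree) : HCK k := (s.map (tree k)).prod

/-- The algebra morphism with prescribed values on the trees. -/
noncomputable def lift {B : Type*} [CommRing B] [Algebra k B] (f : RTree → B) : HCK k →ₐ[k] B :=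
  MvPolynomial.aeval (R := k) f

/-- The linear operator `B₊`, which grafts the trees of a forest on a common new root. -/
noncomputable def bPlus : HCK k →ₗ[k] HCK k :=
  (MvPolynomial.basisMonomials RTree k).constr k
    fun s => tree k (RTree.graft (Finsupp.toMultiset s))

open Classical in
/-- The sum of `crown ⊗ trunk` over all admissible cuts of a (planar) tree. -/
noncomputable def cutSum (t : PTree) : HCK k ⊗[k] HCK k :=
  ∑ W : Set t.Vert with t.IsTrunk W, forest k (t.subforest Wᶜ) ⊗ₜ[k] forest k (t.subforest W)

end HCK

namespace PTree

theorem Iso.exists_orderIso : ∀ {s t : PTree}, Iso s t →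
    ∃ e : Vert s ≃o Vert t, ∀ W : Set (Vert t), components s (e ⁻¹' W) = components t W
  | node n c, node m d, ⟨σ, h⟩ => by
    choose e he using fun i => Iso.exists_orderIso (h i)
    let E : (Σ i : Fin n, Vert (c i)) ≃ (Σ i : Fin m, Vert (d i)) :=
      Equiv.sigmaCongr σ fun i => (e i).toEquiv
    have hE : ∀ i v, E ⟨i, v⟩ = ⟨σ i, e i v⟩ := fun i v => rfl
    let F : (Σ i : Fin n, Vert (c i)) ≃o (Σ i : Fin m, Vert (d i)) :=
      { E with
        map_rel_iff' := by
          rintro ⟨i, v⟩ ⟨j, w⟩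
          rw [hE, hE]
          constructor
          · intro hle
            obtain rfl : i = j := by
              rw [Sigma.le_def] at hle
              exact σ.injective hle.1
            rw [Sigma.mk_le_mk_iff] at hle ⊢
            exact (e i).le_iff_le.1 hle
          · intro hle
            obtain rfl : i = j := by
              rw [Sigma.le_def] at hle
              exact hle.1
            rw [Sigma.mk_le_mk_iff] at hle ⊢
            exact (e i).le_iff_le.2 hle }
    let G : Vert (node n c) ≃o Vert (node m d) :=
      (F.withBotCongr : WithBot (Σ i : Fin n, Vert (c i)) ≃o WithBot (Σ i : Fin m, Vert (d i)))
    refine ⟨G, fun W => ?_⟩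
    have hb : ∀ i, components (c i) (branchSet (G ⁻¹' W) i) =
        components (d (σ i)) (branchSet W (σ i)) := fun i => he i (branchSet W (σ i))
    have h1 : ∑ i, (components (c i) (branchSet (G ⁻¹' W) i)).1 =
        ∑ i, (components (d i) (branchSet W i)).1 :=
      Fintype.sum_equiv σ _ _ fun i => by rw [hb i]
    have h2 : ∑ i, (components (c i) (branchSet (G ⁻¹' W) i)).2 =
        ∑ i, (components (d i) (branchSet W i)).2 :=
      Fintype.sum_equiv σ _ _ fun i => by rw [hb i]
    have h3 : Vert.root ∈ G ⁻¹' W ↔ Vert.root ∈ W := Iff.rfl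
    simp only [components, h1, h2]
    by_cases hr : Vert.root ∈ W
    · rw [if_pos hr, if_pos (h3.2 hr)]
    · rw [if_neg hr, if_neg (h3.not.2 hr)]

end PTree

namespace HCK

variable (k : Type*) [Field k]

theorem cutSum_eq {s t : PTree} (h : s.Iso t) : cutSum k s = cutSum k t := by
  classical
  obtain ⟨e, he⟩ := h.exists_orderIso
  have hs : ∀ W : Set t.Vert, s.subforest (e ⁻¹' W) = t.subforest W := fun W => by
    simp only [PTree.subforest, he]
  unfold cutSum
  symm
  refine Finset.sum_equiv (Equiv.Set.congr e.toEquiv).symm (fun W => ?_) (fun W _ => ?_)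
  · have hW : (Equiv.Set.congr e.toEquiv).symm W = e ⁻¹' W := by
      change e.symm '' W = e ⁻¹' W
      exact e.symm.toEquiv.image_eq_preimage_symm W
    rw [hW, Finset.mem_filter_univ, Finset.mem_filter_univ]
    unfold PTree.IsTrunk
    constructor
    · intro H x hx y hy hc
      exact e.lt_iff_lt.1 (H (e x) hx (e y) hy (by simpa using hc))
    · intro H x hx y hy hc
      have := H (e.symm x) (by simpa using hx) (e.symm y) (by simpa using hy) (by simpa using hc)
      simpa using this
  · have hW : (Equiv.Set.congr e.toEquiv).symm W = e ⁻¹' W := by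
      change e.symm '' W = e ⁻¹' W
      exact e.symm.toEquiv.image_eq_preimage_symm W
    rw [hW, ← Set.preimage_compl, hs, hs]

/-- The sum of `crown ⊗ trunk` over all admissible cuts of a rooted tree `t` (including the empty
cut and the total cut). -/
noncomputable def comulTree (t : RTree) : HCK k ⊗[k] HCK k :=
  Quotient.lift (cutSum k) (fun _ _ h => cutSum_eq k h) t

/-- The coproduct is the multiplicative extension of the sum over the admissible cuts. The counit
`ε` is `1` on the empty forest and `0` on the other forests. -/
noncomputable instance : CoalgebraStruct k (HCK k) where
  comul := (lift k (comulTree k)).toLinearMap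
  counit := (lift k (fun _ => (0 : k))).toLinearMap

open Classical in
/-- The character `δ` which is `1` on the one-vertex tree and `0` on the other trees. -/
noncomputable def delta : HCK k →ₗ[k] k :=
  (lift k (fun t => if t = RTree.bullet then (1 : k) else 0)).toLinearMap

end HCK

/-! ## The quasi-shuffle Hopf algebra on one letter -/

/-- The vector space `T(k) = k[x]` on the words `xⁿ` in one letter `x`. -/
def QSh (k : Type*) [Field k] : Type _ := ℕ →₀ k

namespace QSh

variable (k : Type*) [Field k]

noncomputable instance : AddCommGroup (QSh k) := inferInstanceAs (AddCommGroup (ℕ →₀ k))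

noncomputable instance : Module k (QSh k) := inferInstanceAs (Module k (ℕ →₀ k))

/-- The word `xⁿ`. -/
noncomputable def word (n : ℕ) : QSh k := Finsupp.single (M := k) n 1

/-- The linear map with prescribed values on the words. -/
noncomputable def lift {B : Type*} [AddCommGroup B] [Module k B] (f : ℕ → B) : QSh k →ₗ[k] B :=
  Finsupp.linearCombination (α := ℕ) k f

/-- The coefficient of the word `xⁿ`. -/
noncomputable def coeff (n : ℕ) : QSh k →ₗ[k] k := Finsupp.lapply (M := k) (R := k) n

/-- Concatenation with the letter `x` (on the right, or equivalently on the left, as there is only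
one letter): `xⁿ ↦ xⁿ⁺¹`. -/
noncomputable def concat : QSh k →ₗ[k] QSh k := lift k fun n => word k (n + 1)

/-- The quasi-shuffle product of the words `xᵏ` and `xˡ`, where `[xx] = x`:
`(x u) ⋄ (x v) = x (u ⋄ x v) + x (x u ⋄ v) + [xx] (u ⋄ v)`. -/
noncomputable def mulWord : ℕ → ℕ → QSh k
  | 0, m => word k m
  | n + 1, 0 => word k (n + 1)
  | n + 1, m + 1 =>
    concat k (mulWord n (m + 1)) + concat k (mulWord (n + 1) m) + concat k (mulWord n m)
  termination_by n m => n + m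

/-- The bilinear extension of the quasi-shuffle product of words. -/
noncomputable def mulLin : QSh k →ₗ[k] QSh k →ₗ[k] QSh k :=
  lift k fun n => lift k fun m => mulWord k n m

noncomputable instance : Mul (QSh k) := ⟨fun a b => mulLin k a b⟩

noncomputable instance : One (QSh k) := ⟨word k 0⟩

variable {k}

theorem lift_word {B : Type*} [AddCommGroup B] [Module k B] (f : ℕ → B) (n : ℕ) :
    lift k f (word k n) = f n := by
  unfold lift word
  erw [Finsupp.linearCombination_single]
  simp

theorem hom_ext {B : Type*} [AddCommGroup B] [Module k B] {f g : QSh k →ₗ[k] B}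
    (h : ∀ n, f (word k n) = g (word k n)) : f = g :=
  Finsupp.lhom_ext' (M := k) (R := k) fun n => LinearMap.ext_ring (h n)

/-- Auxiliary realization of words as functions: `xⁿ ↦ (N ↦ binomial(N, n))`. -/
noncomputable def binom : QSh k →ₗ[k] (ℕ → k) := lift k fun n N => (N.choose n : k)

theorem binom_word (n N : ℕ) : binom (word k n) N = (N.choose n : k) := by
  unfold binom; rw [lift_word]

theorem binom_concat_zero (a : QSh k) : binom (concat k a) 0 = 0 := by
  have : (LinearMap.proj 0 ∘ₗ binom) ∘ₗ concat k = (0 : QSh k →ₗ[k] k) :=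
    hom_ext fun n => by simp [concat, lift_word, binom_word]
  exact LinearMap.congr_fun this a

theorem binom_concat_succ (a : QSh k) (N : ℕ) :
    binom (concat k a) (N + 1) = binom (concat k a) N + binom a N := by
  have : (LinearMap.proj (N + 1) ∘ₗ binom) ∘ₗ concat k =
      (LinearMap.proj N ∘ₗ binom) ∘ₗ concat k + (LinearMap.proj N ∘ₗ binom : QSh k →ₗ[k] k) :=
    hom_ext fun n => by
      simp [concat, lift_word, binom_word, Nat.choose_succ_succ, add_comm]
  exact LinearMap.congr_fun this a

theorem binom_mulWord (n m N : ℕ) :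
    binom (mulWord k n m) N = (N.choose n : k) * (N.choose m : k) := by
  induction n, m using mulWord.induct generalizing N with
  | case1 m => simp [mulWord, binom_word]
  | case2 n => simp [mulWord, binom_word]
  | case3 n m h1 h2 h3 =>
    induction N with
    | zero => simp [mulWord, binom_concat_zero]
    | succ N ih =>
      rw [mulWord] at ih ⊢
      simp only [map_add, Pi.add_apply] at ih
      simp only [map_add, Pi.add_apply, binom_concat_succ, h1, h2, h3]
      rw [Nat.choose_succ_succ, Nat.choose_succ_succ]
      push_cast
      linear_combination ih

theorem binom_mul (a b : QSh k) : binom (a * b) = binom a * binom b := by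
  have : (mulLin k).compr₂ binom =
      (LinearMap.mul k (ℕ → k)).compl₁₂ (binom (k := k)) (binom (k := k)) := by
    refine hom_ext fun n => hom_ext fun m => funext fun N => ?_
    simp [mulLin, lift_word, binom_mulWord, binom_word]
  exact LinearMap.congr_fun₂ this a b

theorem binom_one : binom (1 : QSh k) = 1 := funext fun N => by
  change binom (word k 0) N = 1
  simp [binom_word]

theorem binom_apply (a : QSh k) (N : ℕ) :
    binom a N = ∑ n ∈ Finset.range (N + 1), (N.choose n : k) * coeff k n a := by
  have : (LinearMap.proj N ∘ₗ binom : QSh k →ₗ[k] k) =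
      ∑ n ∈ Finset.range (N + 1), (N.choose n : k) • coeff k n := hom_ext fun m => by
    have hc : ∀ n, coeff k n (word k m) = if m = n then 1 else 0 := fun n => by
      simp only [coeff, word]
      exact Finsupp.single_apply
    simp only [LinearMap.comp_apply, LinearMap.proj_apply, binom_word, LinearMap.sum_apply,
      LinearMap.smul_apply, hc, smul_eq_mul, mul_ite, mul_one, mul_zero, Finset.sum_ite_eq,
      Finset.mem_range]
    split_ifs with h
    · rfl
    · rw [Nat.choose_eq_zero_of_lt (by omega), Nat.cast_zero]
  simpa using LinearMap.congr_fun this a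

theorem binom_injective : Function.Injective (binom (k := k)) := by
  refine (injective_iff_map_eq_zero binom).2 fun a ha => ?_
  have key : ∀ n, coeff k n a = 0 := fun n => by
    induction n using Nat.strong_induction_on with
    | _ n ih =>
      have h := binom_apply a n
      rw [ha, Finset.sum_range_succ, Finset.sum_eq_zero] at h
      · simpa using h.symm
      · intro i hi
        rw [ih i (Finset.mem_range.1 hi), mul_zero]
  exact Finsupp.ext (f := (a : ℕ →₀ k)) (g := (0 : ℕ →₀ k)) key

noncomputable instance : CommRing (QSh k) :=
  { (inferInstance : AddCommGroup (QSh k)) with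
    mul := (· * ·)
    one := 1
    left_distrib := fun a b c => by
      apply binom_injective; simp only [binom_mul, map_add, mul_add]
    right_distrib := fun a b c => by
      apply binom_injective; simp only [binom_mul, map_add, add_mul]
    zero_mul := fun a => by
      apply binom_injective; simp only [binom_mul, map_zero, zero_mul]
    mul_zero := fun a => by
      apply binom_injective; simp only [binom_mul, map_zero, mul_zero]
    mul_assoc := fun a b c => by
      apply binom_injective; simp only [binom_mul, mul_assoc]
    one_mul := fun a => by
      apply binom_injective; simp only [binom_mul, binom_one, one_mul]
    mul_one := fun a => by
      apply binom_injective; simp only [binom_mul, binom_one, mul_one]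
    mul_comm := fun a b => by
      apply binom_injective; simp only [binom_mul, mul_comm] }

noncomputable instance : Algebra k (QSh k) :=
  Algebra.ofModule
    (fun r a b => by
      apply binom_injective; simp only [binom_mul, map_smul, smul_mul_assoc])
    (fun r a b => by
      apply binom_injective; simp only [binom_mul, map_smul, mul_smul_comm])

/-- Deconcatenation of words, and the counit (the coefficient of the empty word). -/
noncomputable instance : CoalgebraStruct k (QSh k) where
  comul := lift k fun n => ∑ p ∈ Finset.HasAntidiagonal.antidiagonal n, word k p.1 ⊗ₜ[k] word k p.2
  counit := coeff k 0

variable (k)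

/-- The linear map `δ̃`, which is `1` on the empty word and on the word `x`, and `0` on all words of
length at least two. -/
noncomputable def delta : QSh k →ₗ[k] k := lift k fun n => if n ≤ 1 then 1 else 0

end QSh

/-! ## The morphism `Λ` -/

/-- The recursion `Λ(B₊(t₁ ⋯ tₙ)) = (Λ(t₁) ⋄ ⋯ ⋄ Λ(tₙ)) x` on planar trees. -/
noncomputable def PTree.toQSh (k : Type*) [Field k] : PTree → QSh k
  | PTree.node _ c => QSh.concat k (∏ i, PTree.toQSh k (c i))

theorem PTree.Iso.toQSh_eq (k : Type*) [Field k] :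
    ∀ {s t : PTree}, s.Iso t → s.toQSh k = t.toQSh k
  | PTree.node _ c, PTree.node _ d, ⟨σ, h⟩ => by
    simp only [PTree.toQSh]
    congr 1
    exact Fintype.prod_equiv σ _ _ fun i => PTree.Iso.toQSh_eq k (h i)

/-- The algebra morphism `Λ` from the Connes-Kreimer algebra to the quasi-shuffle algebra with
`Λ(B₊(t₁ ⋯ tₙ)) = (Λ(t₁) ⋄ ⋯ ⋄ Λ(tₙ)) x`. -/
noncomputable def Lam (k : Type*) [Field k] : HCK k →ₐ[k] QSh k :=
  HCK.lift k fun t => Quotient.lift (PTree.toQSh k) (fun _ _ h => PTree.Iso.toQSh_eq k h) t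

/-! ## Convolution logarithm -/

section Convolution

variable {k C : Type*} [Field k] [AddCommGroup C] [Module k C] [CoalgebraStruct k C]

/-- The powers `f^{*n}` of a linear form for the convolution product
`f * g = m ∘ (f ⊗ g) ∘ Δ`, whose unit is the counit `ε`. -/
noncomputable def convPow (f : C →ₗ[k] k) : ℕ → (C →ₗ[k] k)
  | 0 => CoalgebraStruct.counit
  | n + 1 => (WithConv.toConv (convPow f n) * WithConv.toConv f).ofConv

/-- The convolution logarithm `log* f = K - K^{*2}/2 + K^{*3}/3 - ⋯`, with `K = f - ε`. On each
element the sum is meant to have only finitely many nonzero terms. -/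
noncomputable def convLog (f : C →ₗ[k] k) (u : C) : k :=
  ∑ᶠ n : ℕ, (-1 : k) ^ n / ((n : k) + 1) * convPow (f - CoalgebraStruct.counit) (n + 1) u

end Convolution

/-- The map `ω = log* δ` on the Connes-Kreimer Hopf algebra. -/
noncomputable def omega (k : Type*) [Field k] : HCK k → k := convLog (HCK.delta k)

/-- The map `ω̃ = log* δ̃` on the quasi-shuffle Hopf algebra. -/
noncomputable def omegaTilde (k : Type*) [Field k] : QSh k → k := convLog (QSh.delta k)

/-- `ω_s(t)`: the number of words of length `s` in `Λ(t)`, i.e. the coefficient of `xˢ`. -/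
noncomputable def omegaCoeff (k : Type*) [Field k] (s : ℕ) (t : RTree) : k :=
  QSh.coeff k s (Lam k (HCK.tree k t))

/-!
The concatenation operator `L` on the quasi-shuffle algebra is a Rota-Baxter operator of weight one,
and both `L` and the grafting operator `B₊` satisfy the Hochschild cocycle identity
`Δ (L a) = L a ⊗ 1 + (id ⊗ L) (Δ a)`. Since every tree is of the form `B₊ (t₁ ⋯ tₙ)`, an identity
between algebra morphisms on `HCK k` has only to be propagated through `B₊`. This proves that `Λ` is
a morphism of bialgebras, that it is unique, and that `δ = δ̃ ∘ Λ`; hence `log* δ = (log* δ̃) ∘ Λ`.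
Finally, `δ̃ - ε` is the linear form dual to the word `x`, so that its convolution powers are
the linear forms dual to the words `xⁿ`.
-/

open TensorProduct CoalgebraStruct

/-! ## Rota-Baxter operators and Hochschild cocycles -/

section RotaBaxter

variable {R A B : Type*} [CommSemiring R] [Semiring A] [Algebra R A] [Semiring B] [Algebra R B]

/-- `P` is a Rota-Baxter operator of weight one, an abstract summation operator: this is the shape
of the recursion which defines quasi-shuffle products. -/
def IsRotaBaxter (P : A →ₗ[R] A) : Prop :=
  ∀ a b, P a * P b = P (a * P b + P a * b + a * b)

/-- `P` is a `1`-cocycle for the Hochschild cohomology of coalgebras, where the right coaction is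
twisted by the counit. -/
def IsHochschildCocycle [CoalgebraStruct R A] (P : A →ₗ[R] A) : Prop :=
  ∀ a, comul (R := R) (P a) = P a ⊗ₜ[R] 1 + P.lTensor A (comul a)

theorem lTensor_tmul_one_mul (P : B →ₗ[R] B) (a : A) (z : A ⊗[R] B) :
    P.lTensor A (a ⊗ₜ 1 * z) = a ⊗ₜ 1 * P.lTensor A z := by
  induction z using TensorProduct.induction_on with
  | zero => simp
  | tmul x y => simp
  | add z w hz hw => simp only [mul_add, map_add, hz, hw]

theorem lTensor_mul_tmul_one (P : B →ₗ[R] B) (a : A) (z : A ⊗[R] B) :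
    P.lTensor A (z * a ⊗ₜ 1) = P.lTensor A z * a ⊗ₜ 1 := by
  induction z using TensorProduct.induction_on with
  | zero => simp
  | tmul x y => simp
  | add z w hz hw => simp only [add_mul, map_add, hz, hw]

theorem IsRotaBaxter.lTensor {P : B →ₗ[R] B} (hP : IsRotaBaxter P) :
    IsRotaBaxter (P.lTensor A) := fun z w => by
  induction z using TensorProduct.induction_on with
  | zero => simp
  | add z₁ z₂ h₁ h₂ =>
    simp only [add_mul, map_add, h₁, h₂]
    abel
  | tmul a b =>
    induction w using TensorProduct.induction_on with
    | zero => simp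
    | add w₁ w₂ h₁ h₂ =>
      simp only [mul_add, map_add, h₁, h₂]
      abel
    | tmul a' b' =>
      simp only [LinearMap.lTensor_tmul, Algebra.TensorProduct.tmul_mul_tmul, hP b b', map_add,
        tmul_add]

theorem IsRotaBaxter.comul_mul [CoalgebraStruct R A] {P : A →ₗ[R] A} (hP : IsRotaBaxter P)
    (hΔ : IsHochschildCocycle P) {a b : A}
    (hl : comul (R := R) (a * P b) = comul a * comul (P b))
    (hr : comul (R := R) (P a * b) = comul (P a) * comul b)
    (h : comul (R := R) (a * b) = comul a * comul b) :
    comul (R := R) (P a * P b) = comul (P a) * comul (P b) := by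
  calc comul (P a * P b)
      = (P a * P b) ⊗ₜ 1 + P.lTensor A (comul a * (P b ⊗ₜ 1 + P.lTensor A (comul b)) +
          (P a ⊗ₜ 1 + P.lTensor A (comul a)) * comul b + comul a * comul b) := by
        rw [hP a b, hΔ, map_add (comul (R := R)), map_add (comul (R := R)), hl, hr, h, hΔ a, hΔ b]
    _ = (P a * P b) ⊗ₜ 1 + P.lTensor A (comul a * P b ⊗ₜ 1) + P.lTensor A (P a ⊗ₜ 1 * comul b) +
          P.lTensor A (comul a * P.lTensor A (comul b) + P.lTensor A (comul a) * comul b +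
            comul a * comul b) := by
        simp only [mul_add, add_mul, map_add]
        abel
    _ = (P a ⊗ₜ 1 + P.lTensor A (comul a)) * (P b ⊗ₜ 1 + P.lTensor A (comul b)) := by
        rw [lTensor_mul_tmul_one, lTensor_tmul_one_mul, ← hP.lTensor, mul_add, add_mul, add_mul,
          Algebra.TensorProduct.tmul_mul_tmul, one_mul]
        abel
    _ = comul (P a) * comul (P b) := by rw [hΔ, hΔ]

end RotaBaxter

theorem prod_tmul_prod {R A B ι : Type*} [CommSemiring R] [CommSemiring A] [CommSemiring B]
    [Algebra R A] [Algebra R B] (s : Finset ι) (a : ι → A) (b : ι → B) :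
    ∏ i ∈ s, a i ⊗ₜ[R] b i = (∏ i ∈ s, a i) ⊗ₜ[R] ∏ i ∈ s, b i := by
  classical
  induction s using Finset.induction_on with
  | empty => simp only [Finset.prod_empty, Algebra.TensorProduct.one_def]
  | insert i s hi ih =>
    simp only [Finset.prod_insert hi, ih, Algebra.TensorProduct.tmul_mul_tmul]

/-! ## Functoriality of the convolution logarithm -/

section Convolution

variable {k C D : Type*} [Field k] [AddCommGroup C] [Module k C] [CoalgebraStruct k C]
  [AddCommGroup D] [Module k D] [CoalgebraStruct k D]

theorem convPow_comp_coalgHom (f : D →ₗ[k] k) (φ : C →ₗc[k] D) (n : ℕ) :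
    convPow (f ∘ₗ φ.toLinearMap) n = convPow f n ∘ₗ φ.toLinearMap := by
  induction n with
  | zero => exact φ.counit_comp.symm
  | succ n ih =>
    simp only [convPow, ih, LinearMap.convMul_def, WithConv.ofConv_toConv, TensorProduct.map_comp,
      LinearMap.comp_assoc, φ.map_comp_comul]

theorem convPow_sub_counit_comp_coalgHom (f : D →ₗ[k] k) (φ : C →ₗc[k] D) (n : ℕ) :
    convPow (f ∘ₗ φ.toLinearMap - counit) n = convPow (f - counit) n ∘ₗ φ.toLinearMap := by
  rw [← φ.counit_comp, ← LinearMap.sub_comp, convPow_comp_coalgHom]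

theorem convLog_comp_coalgHom (f : D →ₗ[k] k) (φ : C →ₗc[k] D) (u : C) :
    convLog (f ∘ₗ φ.toLinearMap) u = convLog f (φ u) := by
  simp only [convLog, convPow_sub_counit_comp_coalgHom]
  rfl

end Convolution

/-! ## The quasi-shuffle algebra -/

namespace QSh

variable {k : Type*} [Field k]

theorem coeff_word (n m : ℕ) : coeff k n (word k m) = if m = n then 1 else 0 :=
  Finsupp.single_apply

theorem coeff_ext {a b : QSh k} (h : ∀ n, coeff k n a = coeff k n b) : a = b :=
  Finsupp.ext (f := (a : ℕ →₀ k)) (g := (b : ℕ →₀ k)) h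

theorem concat_word (n : ℕ) : concat k (word k n) = word k (n + 1) := lift_word _ n

theorem word_mul_word (n m : ℕ) : word k n * word k m = mulWord k n m := by
  change mulLin k (word k n) (word k m) = _
  rw [mulLin, lift_word, lift_word]

theorem comul_word (n : ℕ) : comul (R := k) (word k n) =
    ∑ p ∈ Finset.HasAntidiagonal.antidiagonal n, word k p.1 ⊗ₜ[k] word k p.2 := lift_word _ n

theorem comul_one : comul (R := k) (1 : QSh k) = 1 := by
  change comul (word k 0) = _
  rw [comul_word, Finset.Nat.antidiagonal_zero, Finset.sum_singleton]
  rfl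

theorem counit_eq_coeff : (counit : QSh k →ₗ[k] k) = coeff k 0 := rfl

theorem counit_concat (a : QSh k) : counit (R := k) (concat k a) = 0 := by
  have h : coeff k 0 ∘ₗ concat k = 0 := hom_ext fun n => by simp [concat_word, coeff_word]
  exact LinearMap.congr_fun h a

-- Under `binom`, concatenation becomes summation from `0` to `N - 1`, so that this is summation by
-- parts.
theorem isRotaBaxter_concat : IsRotaBaxter (concat k) := fun a b => by
  refine binom_injective (funext fun N => ?_)
  induction N with
  | zero => simp only [binom_mul, Pi.mul_apply, binom_concat_zero, zero_mul]
  | succ N ih =>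
    simp only [binom_mul, map_add, Pi.add_apply, Pi.mul_apply, binom_concat_succ] at ih ⊢
    linear_combination ih

theorem isHochschildCocycle_concat : IsHochschildCocycle (concat k) := by
  have h : comul ∘ₗ concat k =
      (TensorProduct.mk k (QSh k) (QSh k)).flip 1 ∘ₗ concat k +
        (concat k).lTensor (QSh k) ∘ₗ comul := hom_ext fun n => by
    simp only [LinearMap.comp_apply, LinearMap.add_apply, concat_word, comul_word, map_sum,
      LinearMap.lTensor_tmul, LinearMap.flip_apply, TensorProduct.mk_apply]
    rw [Finset.Nat.sum_antidiagonal_succ']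
    rfl
  exact LinearMap.congr_fun h

theorem comul_word_mul_word (n m : ℕ) :
    comul (R := k) (word k n * word k m) = comul (word k n) * comul (word k m) := by
  induction n generalizing m with
  | zero =>
    change comul (1 * _) = comul 1 * _
    rw [one_mul, comul_one, one_mul]
  | succ n ihn =>
    induction m with
    | zero =>
      change comul (_ * 1) = _ * comul 1
      rw [mul_one, comul_one, mul_one]
    | succ m ihm =>
      simp only [← concat_word] at ihn ihm ⊢
      refine isRotaBaxter_concat.comul_mul isHochschildCocycle_concat ?_ ihm (ihn m)
      simpa only [concat_word] using ihn (m + 1)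

theorem comul_mul (a b : QSh k) : comul (R := k) (a * b) = comul a * comul b := by
  have h : (LinearMap.mul k (QSh k)).compr₂ comul =
      (LinearMap.mul k (QSh k ⊗[k] QSh k)).compl₁₂ comul comul :=
    hom_ext fun n => hom_ext fun m => comul_word_mul_word n m
  exact LinearMap.congr_fun₂ h a b

variable (k) in
/-- Deconcatenation as a morphism of algebras for the quasi-shuffle product. -/
noncomputable def comulAlgHom : QSh k →ₐ[k] QSh k ⊗[k] QSh k :=
  AlgHom.ofLinearMap comul comul_one comul_mul

theorem comulAlgHom_apply (a : QSh k) : comulAlgHom k a = comul a := rfl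

/-- The character `xⁿ ↦ binomial(N, n)`: it is the counit for `N = 0` and `δ̃` for `N = 1`. -/
noncomputable def eval (N : ℕ) : QSh k →ₐ[k] k :=
  AlgHom.ofLinearMap (LinearMap.proj N ∘ₗ binom) (congrFun binom_one N)
    fun a b => congrFun (binom_mul a b) N

theorem eval_apply (N : ℕ) (a : QSh k) : eval N a = binom a N := rfl

theorem eval_zero (a : QSh k) : eval 0 a = counit (R := k) a := by
  simp [eval_apply, binom_apply, counit_eq_coeff]

theorem eval_one (a : QSh k) : eval 1 a = delta k a := by
  have h : (eval 1).toLinearMap = delta k := hom_ext fun n => by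
    rw [delta, lift_word, AlgHom.toLinearMap_apply, eval_apply, binom_word]
    rcases n with _ | _ | n <;> simp [Nat.choose_eq_zero_of_lt]
  exact LinearMap.congr_fun h a

theorem delta_concat (a : QSh k) : delta k (concat k a) = counit a := by
  rw [← eval_one, eval_apply, binom_concat_succ, binom_concat_zero, zero_add, ← eval_apply,
    eval_zero]

variable (k) in
/-- The span of the words of length at most `d`. -/
noncomputable def filtration (d : ℕ) : Submodule k (QSh k) :=
  (Finsupp.supported k k (Set.Iic d) :)

theorem mem_filtration_iff {a : QSh k} {d : ℕ} :
    a ∈ filtration k d ↔ ∀ n, d < n → coeff k n a = 0 :=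
  (Finsupp.mem_supported' k (a : ℕ →₀ k)).trans <| by simp only [Set.mem_Iic, not_le]; rfl

theorem filtration_eq_span (d : ℕ) : filtration k d = Submodule.span k (word k '' Set.Iic d) :=
  Finsupp.supported_eq_span_single k (Set.Iic d)

theorem word_mem_filtration {n d : ℕ} (h : n ≤ d) : word k n ∈ filtration k d :=
  mem_filtration_iff.2 fun m hm => by rw [coeff_word, if_neg (by omega)]

theorem eventually_coeff_eq_zero (a : QSh k) : ∃ N, ∀ n ≥ N, coeff k n a = 0 := by
  obtain ⟨N, hN⟩ := (Finsupp.support (a : ℕ →₀ k)).exists_nat_subset_range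
  refine ⟨N, fun n hn => by_contra fun h => hn.not_gt ?_⟩
  exact Finset.mem_range.1 (hN (Finsupp.mem_support_iff.2 h))

theorem filtration_mono : Monotone (filtration k) := fun _ _ h =>
  Finsupp.supported_mono (Set.Iic_subset_Iic.2 h)

theorem concat_mem_filtration {a : QSh k} {d : ℕ} (ha : a ∈ filtration k d) :
    concat k a ∈ filtration k (d + 1) := by
  have h : filtration k d ≤ (filtration k (d + 1)).comap (concat k) := by
    rw [filtration_eq_span, Submodule.span_le]
    rintro _ ⟨n, hn, rfl⟩
    rw [SetLike.mem_coe, Submodule.mem_comap, concat_word]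
    exact word_mem_filtration (Nat.succ_le_succ hn)
  exact h ha

theorem mulWord_mem_filtration (n m : ℕ) : mulWord k n m ∈ filtration k (n + m) := by
  induction n, m using mulWord.induct with
  | case1 m => rw [mulWord]; exact word_mem_filtration (by omega)
  | case2 n => rw [mulWord]; exact word_mem_filtration (by omega)
  | case3 n m h₁ h₂ h₃ =>
    rw [mulWord]
    refine add_mem (add_mem ?_ ?_) ?_
    · exact filtration_mono (by omega) (concat_mem_filtration h₁)
    · exact filtration_mono (by omega) (concat_mem_filtration h₂)
    · exact filtration_mono (by omega) (concat_mem_filtration h₃)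

theorem filtration_mul_le (d e : ℕ) : filtration k d * filtration k e ≤ filtration k (d + e) := by
  rw [filtration_eq_span d, filtration_eq_span e, Submodule.span_mul_span, Submodule.span_le]
  rintro _ ⟨_, ⟨n, hn, rfl⟩, _, ⟨m, hm, rfl⟩, rfl⟩
  simp only [word_mul_word]
  exact filtration_mono (Nat.add_le_add hn hm) (mulWord_mem_filtration n m)

instance : SetLike.GradedMonoid (filtration k) where
  one_mem := word_mem_filtration le_rfl
  mul_mem d e _ _ ha hb := filtration_mul_le d e (Submodule.mul_mem_mul ha hb)

theorem eq_sum_of_mem_filtration {a : QSh k} {d : ℕ} (h0 : counit (R := k) a = 0)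
    (ha : a ∈ filtration k d) : a = ∑ s ∈ Finset.Icc 1 d, coeff k s a • word k s := by
  refine coeff_ext fun n => ?_
  simp only [map_sum, map_smul, coeff_word, smul_eq_mul, mul_ite, mul_one, mul_zero,
    Finset.sum_ite_eq', Finset.mem_Icc]
  split_ifs with hn
  · rfl
  · rcases Nat.eq_zero_or_pos n with rfl | hpos
    · exact h0
    · exact mem_filtration_iff.1 ha n (by omega)

theorem delta_sub_counit : delta k - counit = coeff k 1 := hom_ext fun n => by
  rw [counit_eq_coeff, LinearMap.sub_apply, delta, lift_word, coeff_word, coeff_word]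
  rcases n with _ | _ | n <;> simp

theorem coeff_convMul_coeff (i j : ℕ) :
    (WithConv.toConv (coeff k i) * WithConv.toConv (coeff k j)).ofConv = coeff k (i + j) := by
  refine hom_ext fun n => ?_
  have h : ∀ p ∈ Finset.HasAntidiagonal.antidiagonal n,
      coeff k i (word k p.1) * coeff k j (word k p.2) = if p = (i, j) then 1 else 0 := fun _ _ => by
    simp only [coeff_word, ite_mul, one_mul, zero_mul, ← ite_and, Prod.ext_iff]
  change LinearMap.mul' k k (TensorProduct.map (coeff k i) (coeff k j) (comul (word k n))) = _
  simp only [comul_word, map_sum, TensorProduct.map_tmul, LinearMap.mul'_apply]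
  rw [Finset.sum_congr rfl h, Finset.sum_ite_eq']
  simp only [Finset.HasAntidiagonal.mem_antidiagonal, coeff_word, @eq_comm ℕ n]

theorem convPow_delta_sub_counit (n : ℕ) : convPow (delta k - counit) n = coeff k n := by
  rw [delta_sub_counit]
  induction n with
  | zero => rfl
  | succ n ih => rw [convPow, ih, coeff_convMul_coeff]

theorem omegaTilde_eq_sum_of_mem_filtration {a : QSh k} {d : ℕ} (ha : a ∈ filtration k d) :
    omegaTilde k a = ∑ s ∈ Finset.Icc 1 d, (-1) ^ (s + 1) / (s : k) * coeff k s a := by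
  have hsupp : (Function.support fun n : ℕ => (-1 : k) ^ n / ((n : k) + 1) * coeff k (n + 1) a) ⊆
      Finset.range d := fun n hn => by
    rw [Finset.mem_coe, Finset.mem_range]
    by_contra hd
    exact hn (by simp only [mem_filtration_iff.1 ha (n + 1) (by omega), mul_zero])
  simp only [omegaTilde, convLog, convPow_delta_sub_counit]
  rw [finsum_eq_sum_of_support_subset _ hsupp, ← Finset.Ico_add_one_right_eq_Icc,
    Finset.sum_Ico_eq_sum_range]
  refine Finset.sum_congr rfl fun n _ => ?_
  rw [add_comm 1 n, pow_succ, pow_succ]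
  push_cast
  ring

theorem omegaTilde_word {s : ℕ} (hs : 1 ≤ s) :
    omegaTilde k (word k s) = (-1) ^ (s + 1) / (s : k) := by
  rw [omegaTilde_eq_sum_of_mem_filtration (word_mem_filtration le_rfl)]
  simp [coeff_word, hs]

end QSh

/-! ## Grafting -/

namespace RTree

/-- The non-planar tree which underlies a planar tree. -/
def mk (t : PTree) : RTree := Quotient.mk _ t

theorem mk_surjective : Function.Surjective mk := Quotient.exists_rep

theorem mk_eq_mk {s t : PTree} : mk s = mk t ↔ s.Iso t := Quotient.eq

theorem mk_node_eq_mk_node {n m : ℕ} {c : Fin n → PTree} {d : Fin m → PTree} :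
    mk (PTree.node n c) = mk (PTree.node m d) ↔
      ∑ i, ({mk (c i)} : Multiset RTree) = ∑ i, {mk (d i)} := by
  classical
  rw [mk_eq_mk]
  refine ⟨fun ⟨σ, hσ⟩ => Fintype.sum_equiv σ _ _ fun i => by rw [mk_eq_mk.2 (hσ i)], fun h => ?_⟩
  have fiberEquiv : ∀ r, Nonempty ({i // mk (c i) = r} ≃ {i // mk (d i) = r}) := fun r => by
    have := congrArg (Multiset.count r) h
    refine Fintype.card_eq.1 ?_
    simpa [Multiset.count_sum', Multiset.count_singleton, Fintype.card_subtype, eq_comm] using this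
  exact ⟨Equiv.ofFiberEquiv fun r => (fiberEquiv r).some,
    fun i => mk_eq_mk.1 (Equiv.ofFiberEquiv_map (fun r => (fiberEquiv r).some) i).symm⟩

theorem sum_mk_out_toList (s : Multiset RTree) :
    ∑ i, ({mk (Quotient.out (s.toList.get i))} : Multiset RTree) = s := by
  have hout : ∀ r : RTree, mk (Quotient.out r) = r := Quotient.out_eq
  simp only [hout, List.get_eq_getElem]
  rw [Fin.sum_univ_fun_getElem s.toList fun r => ({r} : Multiset RTree), ← Multiset.sum_coe,
    ← Multiset.map_coe, Multiset.sum_map_singleton, Multiset.coe_toList]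

theorem exists_sum_mk_eq (s : Multiset RTree) :
    ∃ (n : ℕ) (c : Fin n → PTree), ∑ i, {mk (c i)} = s :=
  ⟨_, _, sum_mk_out_toList s⟩

theorem graft_sum_mk {n : ℕ} (c : Fin n → PTree) :
    graft (∑ i, {mk (c i)}) = mk (PTree.node n c) :=
  mk_node_eq_mk_node.2 (sum_mk_out_toList _)

theorem graft_injective : Function.Injective graft := fun s s' h => by
  obtain ⟨n, c, rfl⟩ := exists_sum_mk_eq s
  obtain ⟨m, d, rfl⟩ := exists_sum_mk_eq s'
  rwa [graft_sum_mk, graft_sum_mk, mk_node_eq_mk_node] at h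

theorem induction_graft {p : RTree → Prop} (h : ∀ s, (∀ t ∈ s, p t) → p (graft s)) (t : RTree) :
    p t := by
  obtain ⟨t, rfl⟩ := mk_surjective t
  induction t with
  | node n c ih =>
    rw [← graft_sum_mk]
    refine h _ fun t ht => ?_
    obtain ⟨i, -, hi⟩ := Multiset.mem_sum.1 ht
    rw [Multiset.mem_singleton.1 hi]
    exact ih i

end RTree

/-! ## Admissible cuts -/

namespace PTree

variable {n : ℕ} {c : Fin n → PTree}

namespace Vert

theorem root_le (v : Vert (node n c)) : root ≤ v :=
  (bot_le : (⊥ : WithBot (Σ i : Fin n, Vert (c i))) ≤ v)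

theorem inBranch_ne_root {i : Fin n} {v : Vert (c i)} :
    (inBranch i v : Vert (node n c)) ≠ root :=
  WithBot.coe_ne_bot (α := Σ i : Fin n, Vert (c i))

theorem inBranch_le_inBranch {i j : Fin n} {v : Vert (c i)} {w : Vert (c j)} :
    (inBranch i v : Vert (node n c)) ≤ inBranch j w ↔ ∃ h : i = j, h ▸ v ≤ w :=
  (WithBot.coe_le_coe (α := Σ i : Fin n, Vert (c i))).trans Sigma.le_def

theorem inBranch_mono (i : Fin n) :
    Monotone (inBranch i : Vert (c i) → Vert (node n c)) := fun _ _ h =>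
  inBranch_le_inBranch.2 ⟨rfl, h⟩

theorem eq_root_or_inBranch (x : Vert (node n c)) : x = root ∨ ∃ i v, x = inBranch i v := by
  rcases x with _ | ⟨i, v⟩
  · exact Or.inl rfl
  · exact Or.inr ⟨i, v, rfl⟩

end Vert

theorem isTrunk_iff_isLowerSet {t : PTree} {W : Set (Vert t)} : IsTrunk t W ↔ IsLowerSet W := by
  constructor
  · intro h x y hyx hx
    by_contra hy
    exact (h x hx y hy (Or.inr hyx)).not_ge hyx
  · rintro h x hx y hy (hxy | hyx)
    · exact lt_of_le_of_ne hxy fun e => hy (e ▸ hx)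
    · exact absurd (h hyx hx) hy

/-- The set which consists of the root and of the sets `V i` of vertices of the branches. The
non-empty trunks are the sets `rootedSet V` for trunks `V i`. -/
def rootedSet (V : ∀ i, Set (Vert (c i))) : Set (Vert (node n c)) :=
  {x | ∀ i v, x = Vert.inBranch i v → v ∈ V i}

theorem root_mem_rootedSet (V : ∀ i, Set (Vert (c i))) : Vert.root ∈ rootedSet V :=
  fun _ _ h => absurd h.symm Vert.inBranch_ne_root

theorem branchSet_rootedSet (V : ∀ i, Set (Vert (c i))) : branchSet (rootedSet V) = V := by
  ext i v
  refine ⟨fun h => h i v rfl, fun hv j w h => ?_⟩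
  cases h
  exact hv

theorem rootedSet_branchSet {W : Set (Vert (node n c))} (h : Vert.root ∈ W) :
    rootedSet (branchSet W) = W := by
  ext x
  rcases x.eq_root_or_inBranch with rfl | ⟨i, v, rfl⟩
  · exact iff_of_true (root_mem_rootedSet _) h
  · exact Set.ext_iff.1 (congrFun (branchSet_rootedSet (branchSet W)) i) v

theorem rootedSet_injective : Function.Injective (rootedSet (c := c)) :=
  Function.LeftInverse.injective branchSet_rootedSet

theorem isLowerSet_rootedSet {V : ∀ i, Set (Vert (c i))} :
    IsLowerSet (rootedSet V) ↔ ∀ i, IsLowerSet (V i) := by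
  constructor
  · intro h i
    rw [← branchSet_rootedSet V]
    exact h.preimage (Vert.inBranch_mono i)
  · rintro h x y hyx hx i v rfl
    rcases x.eq_root_or_inBranch with rfl | ⟨j, w, rfl⟩
    · exact absurd (le_antisymm hyx (Vert.root_le _)) Vert.inBranch_ne_root
    · obtain ⟨rfl, hvw⟩ := Vert.inBranch_le_inBranch.1 hyx
      exact h i hvw (hx i w rfl)

theorem isLowerSet_node_iff {W : Set (Vert (node n c))} :
    IsLowerSet W ↔ W = ∅ ∨ ∃ V : ∀ i, Set (Vert (c i)), (∀ i, IsLowerSet (V i)) ∧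
      rootedSet V = W := by
  constructor
  · intro h
    rcases W.eq_empty_or_nonempty with hW | ⟨x, hx⟩
    · exact Or.inl hW
    · have hroot := rootedSet_branchSet (h x.root_le hx)
      exact Or.inr ⟨branchSet W, isLowerSet_rootedSet.1 (by rwa [hroot]), hroot⟩
  · rintro (rfl | ⟨V, hV, rfl⟩)
    · exact isLowerSet_empty
    · exact isLowerSet_rootedSet.2 hV

theorem components_of_root_mem {W : Set (Vert (node n c))} (h : Vert.root ∈ W) :
    components (node n c) W =
      ({RTree.graft (∑ i, (components (c i) (branchSet W i)).1)},
        ∑ i, (components (c i) (branchSet W i)).2) := by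
  rw [components, if_pos h]

theorem components_of_root_notMem {W : Set (Vert (node n c))} (h : Vert.root ∉ W) :
    components (node n c) W = (0, ∑ i, subforest (c i) (branchSet W i)) := by
  rw [components, if_neg h]
  simp only [subforest, Finset.sum_add_distrib]

theorem subforest_of_root_notMem {W : Set (Vert (node n c))} (h : Vert.root ∉ W) :
    subforest (node n c) W = ∑ i, subforest (c i) (branchSet W i) := by
  rw [subforest, components_of_root_notMem h, zero_add]

theorem subforest_empty (t : PTree) : subforest t ∅ = 0 := by
  induction t with
  | node n c ih =>
    rw [subforest_of_root_notMem (Set.notMem_empty _)]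
    exact Finset.sum_eq_zero fun i _ => ih i

theorem components_snd_of_isLowerSet {t : PTree} {W : Set (Vert t)} (h : IsLowerSet W) :
    (components t W).2 = 0 := by
  induction t with
  | node n c ih =>
    rcases isLowerSet_node_iff.1 h with rfl | ⟨V, hV, rfl⟩
    · exact (add_eq_zero.1 (subforest_empty (node n c))).2
    · rw [components_of_root_mem (root_mem_rootedSet V), branchSet_rootedSet]
      change ∑ i, (components (c i) (V i)).2 = 0
      exact Finset.sum_eq_zero fun i _ => ih i (hV i)

theorem subforest_of_isLowerSet {t : PTree} {W : Set (Vert t)} (h : IsLowerSet W) :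
    subforest t W = (components t W).1 := by
  rw [subforest, components_snd_of_isLowerSet h, add_zero]

theorem subforest_rootedSet {V : ∀ i, Set (Vert (c i))} (hV : ∀ i, IsLowerSet (V i)) :
    subforest (node n c) (rootedSet V) = {RTree.graft (∑ i, subforest (c i) (V i))} := by
  rw [subforest_of_isLowerSet (isLowerSet_rootedSet.2 hV),
    components_of_root_mem (root_mem_rootedSet V), branchSet_rootedSet]
  simp only [subforest_of_isLowerSet (hV _)]

theorem subforest_compl_rootedSet (V : ∀ i, Set (Vert (c i))) :
    subforest (node n c) (rootedSet V)ᶜ = ∑ i, subforest (c i) (V i)ᶜ := by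
  rw [subforest_of_root_notMem (Set.notMem_compl_iff.2 (root_mem_rootedSet V))]
  conv_rhs => rw [← branchSet_rootedSet V]
  rfl

theorem subforest_univ (t : PTree) : subforest t Set.univ = {RTree.mk t} := by
  induction t with
  | node n c ih =>
    have huniv : rootedSet (fun i => (Set.univ : Set (Vert (c i)))) = Set.univ :=
      rootedSet_branchSet (Set.mem_univ _)
    rw [← huniv, subforest_rootedSet fun _ => isLowerSet_univ, ← RTree.graft_sum_mk]
    simp only [ih]

open Classical in
theorem filter_isTrunk_node (c : Fin n → PTree) :
    ({W | IsTrunk (node n c) W} : Finset (Set (Vert (node n c)))) =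
      insert ∅ ((Fintype.piFinset fun i => {V | IsTrunk (c i) V}).image rootedSet) := by
  ext W
  simp only [Finset.mem_filter_univ, Finset.mem_insert, Finset.mem_image, Fintype.mem_piFinset,
    isTrunk_iff_isLowerSet, isLowerSet_node_iff]

end PTree

/-! ## The Connes-Kreimer algebra -/

namespace HCK

variable {k : Type*} [Field k]

theorem lift_tree {B : Type*} [CommRing B] [Algebra k B] (f : RTree → B) (t : RTree) :
    lift k f (tree k t) = f t := MvPolynomial.aeval_X f t

theorem forest_zero : forest k 0 = 1 := by simp [forest]

theorem forest_singleton (t : RTree) : forest k {t} = tree k t := by simp [forest]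

theorem forest_sum {ι : Type*} (s : Finset ι) (f : ι → Multiset RTree) :
    forest k (∑ i ∈ s, f i) = ∏ i ∈ s, forest k (f i) := by
  classical
  induction s using Finset.induction_on with
  | empty => exact forest_zero
  | insert i s hi ih =>
    rw [Finset.sum_insert hi, Finset.prod_insert hi, ← ih]
    simp only [forest, Multiset.map_add, Multiset.prod_add]

theorem map_forest {A : Type*} [CommSemiring A] [Algebra k A] (f : HCK k →ₐ[k] A)
    (s : Multiset RTree) : f (forest k s) = (s.map fun t => f (tree k t)).prod := by
  rw [forest, map_multiset_prod, Multiset.map_map]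
  rfl

theorem forest_toMultiset (s : RTree →₀ ℕ) :
    forest k (Finsupp.toMultiset s) = MvPolynomial.basisMonomials RTree k s := by
  change ((Finsupp.toMultiset s).map MvPolynomial.X).prod = MvPolynomial.monomial s (1 : k)
  rw [MvPolynomial.monomial_eq, map_one, one_mul, Finsupp.toMultiset_map, Finsupp.prod_toMultiset]
  exact Finsupp.prod_mapDomain_index (fun _ => pow_zero _) (fun _ _ _ => pow_add _ _ _)

theorem bPlus_forest (s : Multiset RTree) : bPlus k (forest k s) = tree k (RTree.graft s) := by
  classical
  obtain ⟨s, rfl⟩ := Multiset.toFinsupp.symm.surjective s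
  change bPlus k (forest k (Finsupp.toMultiset s)) = _
  rw [forest_toMultiset]
  exact (MvPolynomial.basisMonomials RTree k).constr_basis k
    (fun s => tree k (RTree.graft (Finsupp.toMultiset s))) s

theorem linearMap_ext {M : Type*} [AddCommMonoid M] [Module k M] {f g : HCK k →ₗ[k] M}
    (h : ∀ s, f (forest k s) = g (forest k s)) : f = g :=
  (MvPolynomial.basisMonomials RTree k).ext fun s => by
    have := h (Finsupp.toMultiset s)
    rwa [forest_toMultiset] at this

theorem algHom_ext_of_bPlus {A : Type*} [CommSemiring A] [Algebra k A] {f g : HCK k →ₐ[k] A}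
    (h : ∀ u, f u = g u → f (bPlus k u) = g (bPlus k u)) : f = g := by
  refine MvPolynomial.algHom_ext (R := k) (σ := RTree) fun t => ?_
  change f (tree k t) = g (tree k t)
  induction t using RTree.induction_graft with
  | h s ih =>
    rw [← bPlus_forest]
    refine h _ ?_
    rw [map_forest, map_forest, Multiset.map_congr rfl ih]

variable (k) in
/-- The coproduct as a morphism of algebras. -/
noncomputable def comulAlgHom : HCK k →ₐ[k] HCK k ⊗[k] HCK k := lift k (comulTree k)

theorem comulAlgHom_apply (u : HCK k) : comulAlgHom k u = comul u := rfl

theorem comul_tree_mk (t : PTree) : comul (R := k) (tree k (RTree.mk t)) = cutSum k t :=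
  lift_tree _ _

theorem cutSum_node {n : ℕ} (c : Fin n → PTree) : cutSum k (PTree.node n c) =
    tree k (RTree.mk (PTree.node n c)) ⊗ₜ[k] 1 +
      (bPlus k).lTensor (HCK k) (∏ i, cutSum k (c i)) := by
  classical
  have hempty : ∅ ∉ (Fintype.piFinset fun i => ({V | (c i).IsTrunk V} : Finset _)).image
      PTree.rootedSet := fun h => by
    obtain ⟨V, -, hV⟩ := Finset.mem_image.1 h
    exact hV.subset (PTree.root_mem_rootedSet V)
  rw [cutSum, PTree.filter_isTrunk_node, Finset.sum_insert hempty,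
    Finset.sum_image PTree.rootedSet_injective.injOn, Set.compl_empty, PTree.subforest_univ,
    PTree.subforest_empty, forest_singleton, forest_zero]
  simp only [cutSum]
  rw [Finset.prod_univ_sum, map_sum]
  refine congrArg _ (Finset.sum_congr rfl fun V hV => ?_)
  have hlower : ∀ i, IsLowerSet (V i) := fun i =>
    PTree.isTrunk_iff_isLowerSet.1 ((Finset.mem_filter_univ _).1 (Fintype.mem_piFinset.1 hV i))
  rw [PTree.subforest_compl_rootedSet, PTree.subforest_rootedSet hlower, prod_tmul_prod,
    LinearMap.lTensor_tmul, ← forest_sum, ← forest_sum, bPlus_forest, forest_singleton]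

theorem isHochschildCocycle_bPlus : IsHochschildCocycle (bPlus k) := by
  have h : comul ∘ₗ bPlus k = (TensorProduct.mk k (HCK k) (HCK k)).flip 1 ∘ₗ bPlus k +
      (bPlus k).lTensor (HCK k) ∘ₗ comul := linearMap_ext fun s => by
    obtain ⟨n, c, rfl⟩ := RTree.exists_sum_mk_eq s
    have hforest : comul (R := k) (forest k (∑ i, {RTree.mk (c i)})) = ∏ i, cutSum k (c i) := by
      rw [← comulAlgHom_apply, forest_sum, map_prod]
      simp only [forest_singleton, comulAlgHom_apply, comul_tree_mk]
    simp only [LinearMap.comp_apply, LinearMap.add_apply, LinearMap.flip_apply,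
      TensorProduct.mk_apply, bPlus_forest, RTree.graft_sum_mk, hforest, comul_tree_mk, cutSum_node]
  exact LinearMap.congr_fun h

theorem counit_tree (t : RTree) : counit (R := k) (tree k t) = 0 := lift_tree _ t

theorem counit_forest (s : Multiset RTree) : counit (R := k) (forest k s) = 0 ^ s.card := by
  change lift k (fun _ => (0 : k)) (forest k s) = _
  simp only [map_forest, lift_tree, Multiset.map_const', Multiset.prod_replicate]

theorem counit_bPlus (u : HCK k) : counit (R := k) (bPlus k u) = 0 := by
  have h : counit ∘ₗ bPlus k = 0 := linearMap_ext fun s => by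
    rw [LinearMap.comp_apply, bPlus_forest, counit_tree, LinearMap.zero_apply]
  exact LinearMap.congr_fun h u

theorem delta_bPlus (u : HCK k) : delta k (bPlus k u) = counit u := by
  classical
  have h : delta k ∘ₗ bPlus k = counit := linearMap_ext fun s => by
    rw [LinearMap.comp_apply, bPlus_forest, counit_forest, delta, AlgHom.toLinearMap_apply,
      lift_tree, zero_pow_eq]
    simp only [RTree.bullet, RTree.graft_injective.eq_iff, Multiset.card_eq_zero]
  exact LinearMap.congr_fun h u

end HCK

/-! ## The morphism `Λ` -/

namespace Lam

variable {k : Type*} [Field k]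

theorem tree_mk (t : PTree) : Lam k (HCK.tree k (RTree.mk t)) = t.toQSh k := HCK.lift_tree _ _

theorem bPlus (u : HCK k) : Lam k (HCK.bPlus k u) = QSh.concat k (Lam k u) := by
  have h : (Lam k).toLinearMap ∘ₗ HCK.bPlus k = QSh.concat k ∘ₗ (Lam k).toLinearMap :=
    HCK.linearMap_ext fun s => by
      obtain ⟨n, c, rfl⟩ := RTree.exists_sum_mk_eq s
      simp only [LinearMap.comp_apply, AlgHom.toLinearMap_apply, HCK.bPlus_forest,
        RTree.graft_sum_mk, tree_mk, PTree.toQSh]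
      simp only [HCK.forest_sum, map_prod, HCK.forest_singleton, tree_mk]
  exact LinearMap.congr_fun h u

theorem eq_of_bPlus {f : HCK k →ₐ[k] QSh k} (h : ∀ u, f (HCK.bPlus k u) = QSh.concat k (f u)) :
    f = Lam k :=
  HCK.algHom_ext_of_bPlus fun u hu => by rw [h, bPlus, hu]

theorem counit (u : HCK k) : counit (R := k) (Lam k u) = CoalgebraStruct.counit u := by
  have h : (QSh.eval 0).comp (Lam k) = HCK.lift k fun _ => (0 : k) :=
    HCK.algHom_ext_of_bPlus fun u _ => by
      rw [AlgHom.comp_apply, bPlus, QSh.eval_zero, QSh.counit_concat]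
      exact (HCK.counit_bPlus u).symm
  rw [← QSh.eval_zero]
  exact DFunLike.congr_fun h u

theorem delta (u : HCK k) : QSh.delta k (Lam k u) = HCK.delta k u := by
  classical
  have h : (QSh.eval 1).comp (Lam k) =
      HCK.lift k fun t => if t = RTree.bullet then (1 : k) else 0 :=
    HCK.algHom_ext_of_bPlus fun u _ => by
      rw [AlgHom.comp_apply, bPlus, QSh.eval_one, QSh.delta_concat, counit]
      exact (HCK.delta_bPlus u).symm
  rw [← QSh.eval_one]
  exact DFunLike.congr_fun h u

theorem map_lTensor_bPlus (z : HCK k ⊗[k] HCK k) :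
    Algebra.TensorProduct.map (Lam k) (Lam k) ((HCK.bPlus k).lTensor (HCK k) z) =
      (QSh.concat k).lTensor (QSh k) (Algebra.TensorProduct.map (Lam k) (Lam k) z) := by
  induction z using TensorProduct.induction_on with
  | zero => simp only [map_zero]
  | tmul a b => simp only [LinearMap.lTensor_tmul, Algebra.TensorProduct.map_tmul, bPlus]
  | add a b ha hb => simp only [map_add, ha, hb]

theorem comul (u : HCK k) : comul (R := k) (Lam k u) =
    TensorProduct.map (Lam k).toLinearMap (Lam k).toLinearMap (CoalgebraStruct.comul u) := by
  have h : (QSh.comulAlgHom k).comp (Lam k) =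
      (Algebra.TensorProduct.map (Lam k) (Lam k)).comp (HCK.comulAlgHom k) := by
    refine HCK.algHom_ext_of_bPlus fun u hu => ?_
    simp only [AlgHom.comp_apply, QSh.comulAlgHom_apply, HCK.comulAlgHom_apply] at hu ⊢
    rw [bPlus, QSh.isHochschildCocycle_concat, hu, HCK.isHochschildCocycle_bPlus, map_add,
      map_lTensor_bPlus, Algebra.TensorProduct.map_tmul, bPlus, map_one]
  exact DFunLike.congr_fun h u

variable (k) in
/-- `Λ` as a morphism of bialgebras. -/
noncomputable def bialgHom : HCK k →ₐc[k] QSh k where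
  __ := Lam k
  map_smul' := map_smul (Lam k)
  counit_comp := LinearMap.ext counit
  map_comp_comul := LinearMap.ext fun u => (comul u).symm

theorem delta_comp : QSh.delta k ∘ₗ (bialgHom k).toLinearMap = HCK.delta k :=
  LinearMap.ext delta

theorem convPow_delta_sub_counit (n : ℕ) (u : HCK k) :
    convPow (HCK.delta k - CoalgebraStruct.counit) n u = QSh.coeff k n (Lam k u) := by
  rw [← delta_comp, convPow_sub_counit_comp_coalgHom, QSh.convPow_delta_sub_counit]
  rfl

theorem omegaTilde (u : HCK k) : omega k u = omegaTilde k (Lam k u) := by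
  rw [omega, ← delta_comp, convLog_comp_coalgHom]
  rfl

theorem toQSh_mem_filtration (t : PTree) : t.toQSh k ∈ QSh.filtration k t.numVerts := by
  induction t with
  | node n c ih =>
    rw [PTree.toQSh, PTree.numVerts, add_comm]
    exact QSh.concat_mem_filtration (SetLike.prod_mem_graded _ _ _ fun i _ => ih i)

theorem tree_mem_filtration (t : RTree) :
    Lam k (HCK.tree k t) ∈ QSh.filtration k t.numVerts := by
  obtain ⟨t, rfl⟩ := RTree.mk_surjective t
  rw [tree_mk]
  exact toQSh_mem_filtration t

theorem tree_eq_sum (t : RTree) : Lam k (HCK.tree k t) =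
    ∑ s ∈ Finset.Icc 1 t.numVerts, omegaCoeff k s t • QSh.word k s :=
  QSh.eq_sum_of_mem_filtration (by rw [counit, HCK.counit_tree]) (tree_mem_filtration t)

theorem omega_tree_eq_sum {t : RTree} {N : ℕ} (h : t.numVerts ≤ N) : omega k (HCK.tree k t) =
    ∑ s ∈ Finset.Icc 1 N, (-1) ^ (s + 1) / (s : k) * omegaCoeff k s t := by
  rw [omegaTilde]
  exact QSh.omegaTilde_eq_sum_of_mem_filtration (QSh.filtration_mono h (tree_mem_filtration t))

end Lam

theorem mainTheorem8 (k : Type*) [Field k] [CharZero k] :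
    -- `Λ` is a morphism of bialgebras (hence of Hopf algebras) with `Λ ∘ B₊ = L ∘ Λ`, and the only
    -- one, where `L` is the concatenation with the letter `x`
    ((∀ u : HCK k, (CoalgebraStruct.comul (Lam k u) : QSh k ⊗[k] QSh k) =
        TensorProduct.map (Lam k).toLinearMap (Lam k).toLinearMap (CoalgebraStruct.comul u)) ∧
      (∀ u : HCK k, (CoalgebraStruct.counit (Lam k u) : k) = CoalgebraStruct.counit u) ∧
      (∀ u : HCK k, Lam k (HCK.bPlus k u) = QSh.concat k (Lam k u)) ∧
      (∀ Λ' : HCK k →ₐ[k] QSh k,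
        (∀ u : HCK k, Λ' (HCK.bPlus k u) = QSh.concat k (Λ' u)) → Λ' = Lam k)) ∧
    -- the series which define `log* δ` and `log* δ̃` are finite sums on each element
    ((∀ u : HCK k, ∃ N : ℕ, ∀ n ≥ N,
        convPow (HCK.delta k - CoalgebraStruct.counit) n u = 0) ∧
      (∀ a : QSh k, ∃ N : ℕ, ∀ n ≥ N,
        convPow (QSh.delta k - CoalgebraStruct.counit) n a = 0)) ∧
    -- `ω = ω̃ ∘ Λ`, and the values of `ω̃` on the words
    (∀ u : HCK k, omega k u = omegaTilde k (Lam k u)) ∧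
    (∀ s : ℕ, 1 ≤ s → omegaTilde k (QSh.word k s) = (-1) ^ (s + 1) / (s : k)) ∧
    -- the formula for `ω(t)`; the coefficients `ω_s(t)` with `s > |t|` vanish
    (∀ t : RTree,
      Lam k (HCK.tree k t) =
        ∑ s ∈ Finset.Icc 1 t.numVerts, omegaCoeff k s t • QSh.word k s ∧
      ∀ N : ℕ, t.numVerts ≤ N →
        omega k (HCK.tree k t) =
          ∑ s ∈ Finset.Icc 1 N, (-1) ^ (s + 1) / (s : k) * omegaCoeff k s t) := by
  refine ⟨⟨Lam.comul, Lam.counit, Lam.bPlus, fun _ => Lam.eq_of_bPlus⟩, ⟨fun u => ?_, fun a => ?_⟩,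
    Lam.omegaTilde, fun _ => QSh.omegaTilde_word,
    fun t => ⟨Lam.tree_eq_sum t, fun _ => Lam.omega_tree_eq_sum⟩⟩
  · simp only [Lam.convPow_delta_sub_counit]
    exact QSh.eventually_coeff_eq_zero (Lam k u)
  · simp only [QSh.convPow_delta_sub_counit]
    exact QSh.eventually_coeff_eq_zero a
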